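/- Let $K$ be an infinite field and $R=K[x_0,x_1,x_2,x_3]$. "General" means: for all elements of some nonempty Zariski open subset of the space of forms of the given degree. For a finite set $Z\subset\mathbb P^3_K$ of ($K$-rational) points, viewed as a reduced zero-dimensional scheme with homogeneous ideal $I_Z$, the $h$-vector of $Z$ is the first difference of its Hilbert function $t\mapsto\dim_K(R/I_Z)_t$. An Artinian reduction of $R/I_Z$ is an algebra $A=R/(I_Z,\ell)$ with $\ell$ a linear form that is a non-zero-divisor on $R/I_Z$. An Artinian graded algebra is level if its socle is concentrated in one degree, and $Z$ is level if one (hence every) Artinian reduction of $R/I_Z$ is level. A graded Artinian algebra $A$ has WLP if for a general linear form $L$ the map $\times L:A_t\to A_{t+1}$ has maximal rank for all $t$; it has SLP if for every $d$ and a general form $F$ of degree $d$ the map $\times F:A_t\to A_{t+d}$ has maximal rank for all $t$. **Proposition (WLP but not SLP).** For every infinite field $K$ there exists a reduced, level, zero-dimensional scheme (a finite level set of points) $Z\subset\mathbb P^3_K$ with $h$-vector $(1,3,5,7,8,7,6)$ such that, for a general linear form $\ell$, the algebra $A=R/(I_Z,\ell)$ is an Artinian reduction of $R/I_Z$ which has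 WLP but not SLP; more precisely, for a general quadric $Q$ the multiplication map $\times Q:A_3\to A_5$ is not surjective. -/

import Mathlib

open MvPolynomial

noncomputable section

namespace Lefschetz

variable {K : Type*} [Field K] {σ : Type*}

/-- The degree `t` part `(R/J)_t` of the quotient of the polynomial ring `R = K[x_i : i ∈ σ]`
by a (homogeneous) ideal `J`: the image of the space `R_t` of forms of degree `t`. -/
def gradedPiece (J : Ideal (MvPolynomial σ K)) (t : ℕ) :
    Submodule K (MvPolynomial σ K ⧸ J) :=
  (homogeneousSubmodule σ K t).map (Ideal.Quotient.mkₐ K J).toLinearMap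

/-- The Hilbert function `t ↦ dim_K (R/J)_t`. -/
def hilbertFunction (J : Ideal (MvPolynomial σ K)) (t : ℕ) : ℕ :=
  Module.finrank K (gradedPiece J t)

/-- The first difference `t ↦ dim (R/J)_t - dim (R/J)_{t-1}` of the Hilbert function, where
`(R/J)_{-1} = 0`. For the homogeneous ideal of a zero-dimensional scheme this is its `h`-vector. -/
def hVector (J : Ideal (MvPolynomial σ K)) : ℕ → ℤ
  | 0 => hilbertFunction J 0
  | t + 1 => (hilbertFunction J (t + 1) : ℤ) - hilbertFunction J t

/-- The property `P` holds for a general form of degree `d`, i.e. for all forms in a nonempty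
(basic) Zariski open subset of the space of forms of degree `d`. The open subset is the set where
some polynomial `Φ` in the coefficients of the form does not vanish. -/
def ForGeneralForm (d : ℕ) (P : MvPolynomial σ K → Prop) : Prop :=
  ∃ Φ : MvPolynomial (σ →₀ ℕ) K,
    (∃ F : MvPolynomial σ K, F.IsHomogeneous d ∧ eval (fun s => coeff s F) Φ ≠ 0) ∧
    ∀ F : MvPolynomial σ K, F.IsHomogeneous d → eval (fun s => coeff s F) Φ ≠ 0 → P F

/-- Multiplication by the form `F` is injective on `(R/J)_t`. -/
def MulInjective (J : Ideal (MvPolynomial σ K)) (F : MvPolynomial σ K) (t : ℕ) : Prop :=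
  ∀ a ∈ gradedPiece J t, Ideal.Quotient.mk J F * a = 0 → a = 0

/-- Multiplication by `F`, of degree `d`, from `(R/J)_t` to `(R/J)_{t+d}` is surjective. -/
def MulSurjective (J : Ideal (MvPolynomial σ K)) (d : ℕ) (F : MvPolynomial σ K) (t : ℕ) : Prop :=
  ∀ b ∈ gradedPiece J (t + d), ∃ a ∈ gradedPiece J t, Ideal.Quotient.mk J F * a = b

/-- Multiplication by `F`, of degree `d`, from `(R/J)_t` to `(R/J)_{t+d}` has maximal rank. -/
def MulMaximalRank (J : Ideal (MvPolynomial σ K)) (d : ℕ) (F : MvPolynomial σ K) (t : ℕ) : Prop :=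
  MulInjective J F t ∨ MulSurjective J d F t

/-- The Weak Lefschetz Property of the graded algebra `R/J`. -/
def HasWLP (J : Ideal (MvPolynomial σ K)) : Prop :=
  ForGeneralForm 1 fun L => ∀ t : ℕ, MulMaximalRank J 1 L t

/-- The Strong Lefschetz Property of the graded algebra `R/J`. -/
def HasSLP (J : Ideal (MvPolynomial σ K)) : Prop :=
  ∀ d : ℕ, ForGeneralForm d fun F => ∀ t : ℕ, MulMaximalRank J d F t

/-- `R/J` is level: its socle (the set of elements killed by all the variables) is concentrated
in a single degree. -/
def IsLevelArtinian (J : Ideal (MvPolynomial σ K)) : Prop :=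
  IsArtinianRing (MvPolynomial σ K ⧸ J) ∧
    ∃ e : ℕ, ∀ a : MvPolynomial σ K ⧸ J,
      (∀ i : σ, Ideal.Quotient.mk J (X i) * a = 0) → a ∈ gradedPiece J e

/-- The ideal `(I, ℓ)`; the algebra `R/(I, ℓ)` is the reduction of `R/I` by `ℓ`. -/
def reductionIdeal (I : Ideal (MvPolynomial σ K)) (ℓ : MvPolynomial σ K) :
    Ideal (MvPolynomial σ K) :=
  I ⊔ Ideal.span {ℓ}

/-- `R/(I, ℓ)` is an Artinian reduction of the one-dimensional algebra `R/I`: `ℓ` is a linear form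
which is a non-zero-divisor on `R/I`, and `R/(I, ℓ)` is Artinian. -/
def IsArtinianReduction (I : Ideal (MvPolynomial σ K)) (ℓ : MvPolynomial σ K) : Prop :=
  ℓ.IsHomogeneous 1 ∧ Ideal.Quotient.mk I ℓ ∈ nonZeroDivisors (MvPolynomial σ K ⧸ I) ∧
    IsArtinianRing (MvPolynomial σ K ⧸ reductionIdeal I ℓ)

/-- The homogeneous ideal `I_Z` of a finite set `Z` of points of projective space (a reduced
zero-dimensional scheme), generated by the forms vanishing at all points of `Z`. -/
def pointsIdeal (Z : Finset (Projectivization K (σ → K))) : Ideal (MvPolynomial σ K) :=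
  Ideal.span {F | (∃ d : ℕ, F.IsHomogeneous d) ∧ ∀ p ∈ Z, eval p.rep F = 0}

/-- A reduced zero-dimensional scheme `Z` is level if an Artinian reduction of `R/I_Z` is level. -/
def IsLevel (Z : Finset (Projectivization K (σ → K))) : Prop :=
  ∃ ℓ : MvPolynomial σ K, IsArtinianReduction (pointsIdeal Z) ℓ ∧
    IsLevelArtinian (reductionIdeal (pointsIdeal Z) ℓ)

end Lefschetz

end

/-! Start from the monomial ideal `(xy, x⁴, xz⁴, y⁵) + (y, z)⁷` in `K[x, y, z]`. Its standard
monomials are counted by `(1, 3, 5, 7, 8, 7, 6)`, and each of them divides a standard monomial of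
degree 6, so the quotient is level. Replacing every power `x_j ^ a` by `∏_{i < a} (x_j - e_i w)`,
with distinct scalars `e_i`, lifts it to the ideal of 37 points `(e_a : e_b : e_c : 1)`, one for
each standard exponent `(a, b, c)`. The lifting of `m` is nonzero at the point of `n` exactly when
`m ≤ n` (`eval_lifting_ne_zero_iff`). This triangularity gives the Hilbert function and shows that
the forms in the ideal are the combinations of liftings of nonstandard monomials times powers of
`w`. Reduction by `w` gives back the monomial algebra, hence levelness.

The normalization `e 0 = 0` makes `x` a factor of every lifting that involves `x`, and makes `xy`
itself vanish on the points. Write `A` for the reduction by a linear form `ℓ` in general position.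

Failure of SLP: restrict to the line `x = ℓ = 0`. In degree 5 the ideal of the points restricts to
the multiples of one polynomial, the lifting of `y⁵`. So `A / xA` has dimension at most 4 in degree
3 but at least 5 in degree 5, and no quadric can map `A_3` onto `A_5`
(`not_mulSurjective_liftedPoints`). Since `dim A_3 = dim A_5 = 7`, injectivity fails too.

WLP: modulo `ℓ` and a second general linear form `L`, both `z` and `w` are combinations of `x` and
`y`. With `xy = 0` the liftings of `x⁴` and `y⁵` become nonzero multiples of `x⁴` and `y⁵`, so `A /
LA` has Hilbert function at most `(1, 2, 2, 2, 1)` (`hilbertFunction_le`). Comparison with the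
`h`-vector gives injectivity of `×L` from degrees `t ≤ 3` and surjectivity from degrees `t ≥ 4`
(`mulMaximalRank_liftedPoints`). -/

noncomputable section

namespace Lefschetz

/-! ### Graded quotients, multiplication maps and ideals of points -/

section General

variable {K : Type*} [Field K] {σ : Type*}

attribute [local instance] MvPolynomial.gradedAlgebra

/-- All homogeneous components of elements of the ideal lie in the ideal. -/
def IsHomogeneousIdeal (J : Ideal (MvPolynomial σ K)) : Prop :=
  J.IsHomogeneous (homogeneousSubmodule σ K)

lemma IsHomogeneousIdeal.component_mem {J : Ideal (MvPolynomial σ K)} (hJ : IsHomogeneousIdeal J)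
    {F : MvPolynomial σ K} (hF : F ∈ J) (n : ℕ) : homogeneousComponent n F ∈ J :=
  homogeneousComponent_mem_of_mem hJ hF n

lemma IsHomogeneousIdeal.mem_of_component_mem {J : Ideal (MvPolynomial σ K)}
    (hJ : IsHomogeneousIdeal J) {F : MvPolynomial σ K}
    (hF : ∀ n, homogeneousComponent n F ∈ J) : F ∈ J :=
  (mem_iff_homogeneousComponent_mem hJ F).2 hF

lemma isHomogeneousIdeal_span {s : Set (MvPolynomial σ K)}
    (h : ∀ F ∈ s, ∃ d : ℕ, F.IsHomogeneous d) : IsHomogeneousIdeal (Ideal.span s) :=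
  Ideal.homogeneous_span _ s fun F hF => h F hF

lemma isHomogeneousIdeal_pointsIdeal (Z : Finset (Projectivization K (σ → K))) :
    IsHomogeneousIdeal (pointsIdeal Z) :=
  isHomogeneousIdeal_span fun _ hF => hF.1

lemma IsHomogeneousIdeal.reductionIdeal {J : Ideal (MvPolynomial σ K)}
    (hJ : IsHomogeneousIdeal J) {ℓ : MvPolynomial σ K} {d : ℕ} (hℓ : ℓ.IsHomogeneous d) :
    IsHomogeneousIdeal (reductionIdeal J ℓ) :=
  Ideal.IsHomogeneous.sup hJ (isHomogeneousIdeal_span fun F hF => ⟨d, by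
    rw [Set.mem_singleton_iff.1 hF]; exact hℓ⟩)

lemma homogeneousComponent_mul {ℓ : MvPolynomial σ K} {d : ℕ} (hℓ : ℓ.IsHomogeneous d)
    (F : MvPolynomial σ K) (n : ℕ) :
    homogeneousComponent (d + n) (ℓ * F) = ℓ * homogeneousComponent n F := by
  have h := DirectSum.coe_decompose_mul_add_of_left_mem (homogeneousSubmodule σ K) (i := d)
    (j := n) (b := F) ((mem_homogeneousSubmodule d ℓ).2 hℓ)
  have h1 := decomposition.decompose'_apply (ℓ * F) (d + n)
  have h2 := decomposition.decompose'_apply F n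
  rw [← h1, ← h2]
  exact h

lemma mem_gradedPiece {J : Ideal (MvPolynomial σ K)} {t : ℕ} {a : MvPolynomial σ K ⧸ J} :
    a ∈ gradedPiece J t ↔
      ∃ F : MvPolynomial σ K, F.IsHomogeneous t ∧ Ideal.Quotient.mk J F = a := by
  simp [gradedPiece, Submodule.mem_map]

lemma mk_mem_gradedPiece (J : Ideal (MvPolynomial σ K)) {t : ℕ} {F : MvPolynomial σ K}
    (hF : F.IsHomogeneous t) : Ideal.Quotient.mk J F ∈ gradedPiece J t :=
  mem_gradedPiece.2 ⟨F, hF, rfl⟩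

instance finite_gradedPiece [Finite σ] (J : Ideal (MvPolynomial σ K)) (t : ℕ) :
    Module.Finite K (gradedPiece J t) :=
  Module.Finite.iff_fg.2 ((homogeneousSubmodule_fg (R := K) (σ := σ) t).map _)

lemma map_mulLeft_le (J : Ideal (MvPolynomial σ K)) {F : MvPolynomial σ K} {d : ℕ}
    (hF : F.IsHomogeneous d) (t : ℕ) :
    (gradedPiece J t).map (LinearMap.mulLeft K (Ideal.Quotient.mk J F)) ≤
      gradedPiece J (t + d) := by
  rintro _ ⟨a, ha, rfl⟩
  obtain ⟨G, hG, rfl⟩ := mem_gradedPiece.1 ha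
  rw [LinearMap.mulLeft_apply, ← map_mul, add_comm]
  exact mk_mem_gradedPiece J (hF.mul hG)

lemma mulSurjective_iff (J : Ideal (MvPolynomial σ K)) {F : MvPolynomial σ K} {d t : ℕ} :
    MulSurjective J d F t ↔ gradedPiece J (t + d) ≤
      (gradedPiece J t).map (LinearMap.mulLeft K (Ideal.Quotient.mk J F)) :=
  Iff.rfl

/-- An injective multiplication map does not change dimensions. -/
lemma MulInjective.finrank_map {J : Ideal (MvPolynomial σ K)} {F : MvPolynomial σ K} {t : ℕ}
    (h : MulInjective J F t) :
    Module.finrank K ((gradedPiece J t).map (LinearMap.mulLeft K (Ideal.Quotient.mk J F))) =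
      hilbertFunction J t := by
  rw [← LinearMap.range_domRestrict]
  refine LinearMap.finrank_range_of_inj ?_
  rw [injective_iff_map_eq_zero]
  intro a ha
  exact Subtype.ext (h a a.2 ha)

lemma mulInjective_of_le_finrank_map [Finite σ] {J : Ideal (MvPolynomial σ K)}
    {F : MvPolynomial σ K} {t : ℕ} (h : hilbertFunction J t ≤ Module.finrank K
      ((gradedPiece J t).map (LinearMap.mulLeft K (Ideal.Quotient.mk J F)))) :
    MulInjective J F t := by
  rw [← LinearMap.range_domRestrict] at h
  have h1 := LinearMap.finrank_range_add_finrank_ker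
    ((LinearMap.mulLeft K (Ideal.Quotient.mk J F)).domRestrict (gradedPiece J t))
  have h2 : LinearMap.ker
      ((LinearMap.mulLeft K (Ideal.Quotient.mk J F)).domRestrict (gradedPiece J t)) = ⊥ := by
    apply Submodule.finrank_eq_zero.1
    unfold hilbertFunction at h
    omega
  intro a ha h0
  have := LinearMap.ker_eq_bot'.1 h2 ⟨a, ha⟩ h0
  exact congrArg Subtype.val this

/-- A form of positive degree in `(J, ℓ)` is congruent modulo `J` to a multiple of `ℓ`. -/
lemma exists_sub_mul_mem {J : Ideal (MvPolynomial σ K)} (hJ : IsHomogeneousIdeal J)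
    {ℓ : MvPolynomial σ K} {d : ℕ} (hℓ : ℓ.IsHomogeneous d) {t : ℕ} {F : MvPolynomial σ K}
    (hF : F.IsHomogeneous (t + d)) (h : F ∈ reductionIdeal J ℓ) :
    ∃ G : MvPolynomial σ K, G.IsHomogeneous t ∧ F - ℓ * G ∈ J := by
  obtain ⟨i, hi, g, hg, rfl⟩ := Submodule.mem_sup.1 h
  obtain ⟨G, rfl⟩ := Ideal.mem_span_singleton.1 hg
  -- The cofactor of `ℓ` need not be homogeneous; its component of degree `t` suffices because `J`
  -- is homogeneous.
  refine ⟨homogeneousComponent t G, homogeneousComponent_isHomogeneous t G, ?_⟩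
  have h1 : homogeneousComponent (t + d) (i + ℓ * G) = i + ℓ * G := homogeneousComponent_eq_self hF
  rw [← h1, map_add, add_comm t d, homogeneousComponent_mul hℓ, add_sub_cancel_right]
  exact hJ.component_mem hi _

/-- The exact sequence `(R/J)_t → (R/J)_{t+d} → (R/(J,ℓ))_{t+d} → 0` on dimensions. -/
lemma finrank_map_add_hilbertFunction [Finite σ] {J : Ideal (MvPolynomial σ K)}
    (hJ : IsHomogeneousIdeal J) {ℓ : MvPolynomial σ K} {d : ℕ} (hℓ : ℓ.IsHomogeneous d) (t : ℕ) :
    Module.finrank K ((gradedPiece J t).map (LinearMap.mulLeft K (Ideal.Quotient.mk J ℓ))) +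
      hilbertFunction (reductionIdeal J ℓ) (t + d) = hilbertFunction J (t + d) := by
  have hle : J ≤ reductionIdeal J ℓ := le_sup_left
  set g : (MvPolynomial σ K ⧸ J) →ₗ[K] (MvPolynomial σ K ⧸ reductionIdeal J ℓ) :=
    (Ideal.Quotient.factorₐ K hle).toLinearMap with hg
  have hmap : (gradedPiece J (t + d)).map g = gradedPiece (reductionIdeal J ℓ) (t + d) := by
    unfold gradedPiece
    rw [← Submodule.map_comp]
    rfl
  have h1 := LinearMap.finrank_range_add_finrank_ker (g.domRestrict (gradedPiece J (t + d)))
  rw [LinearMap.range_domRestrict, hmap] at h1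
  have hker : (LinearMap.ker (g.domRestrict (gradedPiece J (t + d)))).map
      (gradedPiece J (t + d)).subtype =
      (gradedPiece J t).map (LinearMap.mulLeft K (Ideal.Quotient.mk J ℓ)) := by
    apply le_antisymm
    · rintro _ ⟨⟨a, ha⟩, h0, rfl⟩
      obtain ⟨F, hF, rfl⟩ := mem_gradedPiece.1 ha
      have h0' : Ideal.Quotient.mk (reductionIdeal J ℓ) F = 0 := h0
      obtain ⟨G, hG, hFG⟩ := exists_sub_mul_mem hJ hℓ hF (Ideal.Quotient.eq_zero_iff_mem.1 h0')
      refine ⟨_, mk_mem_gradedPiece J hG, ?_⟩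
      rw [LinearMap.mulLeft_apply, ← map_mul]
      exact (Ideal.Quotient.eq.2 hFG).symm
    · rintro _ ⟨a, ha, rfl⟩
      obtain ⟨G, hG, rfl⟩ := mem_gradedPiece.1 ha
      refine ⟨⟨_, map_mulLeft_le J hℓ t ⟨_, ha, rfl⟩⟩, ?_, rfl⟩
      change Ideal.Quotient.mk (reductionIdeal J ℓ) (ℓ * G) = 0
      rw [Ideal.Quotient.eq_zero_iff_mem]
      exact Ideal.mul_mem_right _ _ (Ideal.mem_sup_right (Ideal.mem_span_singleton_self ℓ))
  rw [← hker]
  have h3 := (Submodule.equivMapOfInjective _ (gradedPiece J (t + d)).injective_subtype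
    (LinearMap.ker (g.domRestrict (gradedPiece J (t + d))))).finrank_eq
  rw [← h3]
  unfold hilbertFunction
  omega

/-- Only the finitely many pieces of degree below `N` survive, each finite-dimensional over `K`. -/
lemma isArtinianRing_of_gradedPiece_eq_bot [Finite σ] {J : Ideal (MvPolynomial σ K)} {N : ℕ}
    (h : ∀ t, N ≤ t → ∀ F : MvPolynomial σ K, F.IsHomogeneous t → F ∈ J) :
    IsArtinianRing (MvPolynomial σ K ⧸ J) := by
  have htop : (⨆ t : Fin N, gradedPiece J t) = ⊤ := by
    rw [eq_top_iff]
    rintro a -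
    obtain ⟨F, rfl⟩ := Ideal.Quotient.mk_surjective a
    rw [← sum_homogeneousComponent F, map_sum]
    refine Submodule.sum_mem _ fun t _ => ?_
    by_cases ht : t < N
    · exact Submodule.mem_iSup_of_mem (p := fun t : Fin N => gradedPiece J t) ⟨t, ht⟩
        (mk_mem_gradedPiece J (homogeneousComponent_isHomogeneous t F))
    · rw [Ideal.Quotient.eq_zero_iff_mem.2
        (h t (not_lt.1 ht) _ (homogeneousComponent_isHomogeneous t F))]
      exact Submodule.zero_mem _
  have hfin : Module.Finite K (MvPolynomial σ K ⧸ J) := by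
    have : Module.Finite K (⨆ t : Fin N, gradedPiece J t : Submodule K _) := inferInstance
    rw [htop] at this
    exact Module.finite_def.2 (Module.Finite.iff_fg.1 this)
  exact isArtinian_of_tower K inferInstance

lemma eval_smul_of_isHomogeneous {F : MvPolynomial σ K} {d : ℕ} (hF : F.IsHomogeneous d) (u : K)
    (v : σ → K) : eval (u • v) F = u ^ d * eval v F := by
  rw [eval_eq, eval_eq, Finset.mul_sum]
  refine Finset.sum_congr rfl fun s hs => ?_
  have hd : ∑ i ∈ s.support, s i = d := hF.degree_eq_sum_deg_support hs |>.symm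
  simp only [Pi.smul_apply, smul_eq_mul, mul_pow, Finset.prod_mul_distrib,
    Finset.prod_pow_eq_pow_sum, hd]
  ring

/-- Rescaling multiplies the value of a form by a power of a unit, so vanishing can be tested on
explicit coordinates instead of the chosen `rep`. -/
lemma eval_rep_mk_eq_zero_iff {F : MvPolynomial σ K} {d : ℕ} (hF : F.IsHomogeneous d)
    {v : σ → K} (hv : v ≠ 0) :
    eval (Projectivization.mk K v hv).rep F = 0 ↔ eval v F = 0 := by
  obtain ⟨u, hu⟩ := Projectivization.exists_smul_eq_mk_rep K v hv
  rw [← hu]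
  have := eval_smul_of_isHomogeneous hF (u : K) v
  change eval ((u : K) • v) F = 0 ↔ _
  rw [this]
  simp

lemma mem_pointsIdeal {Z : Finset (Projectivization K (σ → K))} {F : MvPolynomial σ K} {d : ℕ}
    (hF : F.IsHomogeneous d) : F ∈ pointsIdeal Z ↔ ∀ p ∈ Z, eval p.rep F = 0 := by
  refine ⟨fun h p hp => ?_, fun h => Ideal.subset_span ⟨⟨d, hF⟩, h⟩⟩
  have : pointsIdeal Z ≤ RingHom.ker (eval p.rep) :=
    Ideal.span_le.2 fun G hG => hG.2 p hp
  exact this h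

/-- A form without zeros on `Z` is a non-zero-divisor modulo the ideal of `Z`. -/
lemma mul_mem_pointsIdeal {Z : Finset (Projectivization K (σ → K))} {ℓ : MvPolynomial σ K}
    {d : ℕ} (hℓ : ℓ.IsHomogeneous d) (h : ∀ p ∈ Z, eval p.rep ℓ ≠ 0) {F : MvPolynomial σ K}
    (hF : ℓ * F ∈ pointsIdeal Z) : F ∈ pointsIdeal Z := by
  refine (isHomogeneousIdeal_pointsIdeal Z).mem_of_component_mem fun n => ?_
  have h1 := (isHomogeneousIdeal_pointsIdeal Z).component_mem hF (d + n)
  rw [homogeneousComponent_mul hℓ] at h1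
  have hn := homogeneousComponent_isHomogeneous n F
  rw [mem_pointsIdeal (hℓ.mul hn)] at h1
  rw [mem_pointsIdeal hn]
  intro p hp
  have h2 := h1 p hp
  rw [map_mul] at h2
  exact (mul_eq_zero.1 h2).resolve_left (h p hp)

lemma mulInjective_pointsIdeal {Z : Finset (Projectivization K (σ → K))} {ℓ : MvPolynomial σ K}
    {d : ℕ} (hℓ : ℓ.IsHomogeneous d) (h : ∀ p ∈ Z, eval p.rep ℓ ≠ 0) (t : ℕ) :
    MulInjective (pointsIdeal Z) ℓ t := by
  intro a _ h0
  obtain ⟨F, rfl⟩ := Ideal.Quotient.mk_surjective a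
  rw [← map_mul, Ideal.Quotient.eq_zero_iff_mem] at h0
  exact Ideal.Quotient.eq_zero_iff_mem.2 (mul_mem_pointsIdeal hℓ h h0)

lemma mk_mem_nonZeroDivisors {Z : Finset (Projectivization K (σ → K))} {ℓ : MvPolynomial σ K}
    {d : ℕ} (hℓ : ℓ.IsHomogeneous d) (h : ∀ p ∈ Z, eval p.rep ℓ ≠ 0) :
    Ideal.Quotient.mk (pointsIdeal Z) ℓ ∈ nonZeroDivisors (MvPolynomial σ K ⧸ pointsIdeal Z) := by
  rw [mem_nonZeroDivisors_iff_right]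
  intro a h0
  obtain ⟨F, rfl⟩ := Ideal.Quotient.mk_surjective a
  rw [← map_mul, Ideal.Quotient.eq_zero_iff_mem, mul_comm] at h0
  exact Ideal.Quotient.eq_zero_iff_mem.2 (mul_mem_pointsIdeal hℓ h h0)

/-- The Hilbert function of an Artinian reduction is the `h`-vector. -/
lemma hilbertFunction_reductionIdeal [Finite σ] {Z : Finset (Projectivization K (σ → K))}
    {ℓ : MvPolynomial σ K} (hℓ : ℓ.IsHomogeneous 1) (h : ∀ p ∈ Z, eval p.rep ℓ ≠ 0) (t : ℕ) :
    (hilbertFunction (reductionIdeal (pointsIdeal Z) ℓ) (t + 1) : ℤ) =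
      hVector (pointsIdeal Z) (t + 1) := by
  have h1 := finrank_map_add_hilbertFunction (isHomogeneousIdeal_pointsIdeal Z) hℓ t
  rw [(mulInjective_pointsIdeal hℓ h t).finrank_map] at h1
  simp only [hVector]
  omega

lemma mem_of_hilbertFunction_eq_zero [Finite σ] {J : Ideal (MvPolynomial σ K)} {t : ℕ}
    (h : hilbertFunction J t = 0) {F : MvPolynomial σ K} (hF : F.IsHomogeneous t) : F ∈ J := by
  have h1 := Submodule.finrank_eq_zero.1 h
  have h2 := mk_mem_gradedPiece J hF
  rw [h1, Submodule.mem_bot] at h2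
  exact Ideal.Quotient.eq_zero_iff_mem.1 h2

end General

/-! ### Lifting the monomial ideal to a set of points -/

section Lifting

variable {K : Type*} [Field K]

/-- To place the images of all forms in a graded family of subspaces, it suffices to check that
the family is stable under multiplication by the images of the variables. -/
lemma map_mem_of_isHomogeneous {A : Type*} [CommRing A] [Algebra K A]
    (φ : MvPolynomial (Fin 4) K →ₐ[K] A) (W : ℕ → Submodule K A) (h1 : 1 ∈ W 0)
    (hX : ∀ i t, ∀ a ∈ W t, φ (X i) * a ∈ W (t + 1)) {t : ℕ} {F : MvPolynomial (Fin 4) K}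
    (hF : F.IsHomogeneous t) : φ F ∈ W t := by
  have hpow : ∀ i n t, ∀ a ∈ W t, φ (X i) ^ n * a ∈ W (n + t) := by
    intro i n
    induction n with
    | zero => intro t a ha; simpa using ha
    | succ n ih =>
      intro t a ha
      have := hX i _ _ (ih t a ha)
      rw [← mul_assoc, ← pow_succ'] at this
      convert this using 2
      omega
  rw [F.as_sum, map_sum]
  refine Submodule.sum_mem _ fun s hs => ?_
  have hd : t = s 0 + (s 1 + (s 2 + (s 3 + 0))) := by
    have := hF (mem_support_iff.1 hs)
    rw [← this, Finsupp.weight_apply, Finsupp.sum_fintype _ _ (by simp), Fin.sum_univ_four]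
    simp [add_assoc]
  have hm : monomial s (coeff s F) =
      coeff s F • (X 0 ^ s 0 * (X 1 ^ s 1 * (X 2 ^ s 2 * (X 3 ^ s 3 * 1)))) := by
    rw [monomial_eq, Finsupp.prod_fintype _ _ (by simp), Fin.prod_univ_four, smul_eq_C_mul]
    ring
  rw [hm, map_smul, hd]
  refine Submodule.smul_mem _ _ ?_
  simp only [map_mul, map_pow, map_one]
  exact hpow _ _ _ _ (hpow _ _ _ _ (hpow _ _ _ _ (hpow _ _ _ _ h1)))

/-- The total degree of an exponent. -/
def expDegree (m : ℕ × ℕ × ℕ) : ℕ := m.1 + m.2.1 + m.2.2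

/-- The exponents of the standard monomials of the monomial ideal
`(xy, x⁴, xz⁴, y⁵) + (y, z)⁷`. -/
def IsStandard (m : ℕ × ℕ × ℕ) : Prop :=
  (m.1 = 0 ∧ m.2.1 ≤ 4 ∧ m.2.1 + m.2.2 ≤ 6) ∨ (1 ≤ m.1 ∧ m.1 ≤ 3 ∧ m.2.1 = 0 ∧ m.2.2 ≤ 3)

instance : DecidablePred IsStandard := fun _ => by unfold IsStandard; infer_instance

/-- The finite set of standard exponents. -/
def standardSet : Finset (ℕ × ℕ × ℕ) :=
  (Finset.range 4 ×ˢ Finset.range 5 ×ˢ Finset.range 7).filter IsStandard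

lemma mem_standardSet {m : ℕ × ℕ × ℕ} : m ∈ standardSet ↔ IsStandard m := by
  simp only [standardSet, Finset.mem_filter, Finset.mem_product, Finset.mem_range,
    and_iff_right_iff_imp, IsStandard]
  omega

/-- The standard exponents form an order ideal; this is why liftings of nonstandard monomials vanish
at all the points. -/
lemma IsStandard.of_le {m n : ℕ × ℕ × ℕ} (hn : IsStandard n) (h : m ≤ n) : IsStandard m := by
  obtain ⟨h1, h2, h3⟩ := h
  unfold IsStandard at *
  omega

lemma IsStandard.expDegree_le {m : ℕ × ℕ × ℕ} (h : IsStandard m) : expDegree m ≤ 6 := by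
  unfold IsStandard at h
  unfold expDegree
  omega

/-- The lifting of the monomial with exponent `m`: the powers `x_j ^ a` are replaced by the
products `∏_{i < a} (x_j - e_i w)`. -/
def lifting (e : ℕ → K) (m : ℕ × ℕ × ℕ) : MvPolynomial (Fin 4) K :=
  (∏ i ∈ Finset.range m.1, (X 0 - C (e i) * X 3)) *
    (∏ i ∈ Finset.range m.2.1, (X 1 - C (e i) * X 3)) *
    ∏ i ∈ Finset.range m.2.2, (X 2 - C (e i) * X 3)

/-- The point attached to the exponent `m`. -/
def liftingPoint (e : ℕ → K) (m : ℕ × ℕ × ℕ) : Fin 4 → K := ![e m.1, e m.2.1, e m.2.2, 1]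

lemma liftingPoint_ne_zero (e : ℕ → K) (m : ℕ × ℕ × ℕ) : liftingPoint e m ≠ 0 := fun h => by
  have := congrFun h 3
  simp [liftingPoint] at this

open Classical in
/-- The lifted set of points. -/
def liftedPoints (e : ℕ → K) : Finset (Projectivization K (Fin 4 → K)) :=
  standardSet.image fun m => Projectivization.mk K (liftingPoint e m) (liftingPoint_ne_zero e m)

lemma mem_pointsIdeal_liftedPoints (e : ℕ → K) {F : MvPolynomial (Fin 4) K} {d : ℕ}
    (hF : F.IsHomogeneous d) :
    F ∈ pointsIdeal (liftedPoints e) ↔ ∀ m, IsStandard m → eval (liftingPoint e m) F = 0 := by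
  rw [mem_pointsIdeal hF]
  simp only [liftedPoints, Finset.forall_mem_image, mem_standardSet, eval_rep_mk_eq_zero_iff hF]

lemma eval_rep_ne_zero (e : ℕ → K) {F : MvPolynomial (Fin 4) K} {d : ℕ} (hF : F.IsHomogeneous d)
    (h : ∀ m, IsStandard m → eval (liftingPoint e m) F ≠ 0) :
    ∀ p ∈ liftedPoints e, eval p.rep F ≠ 0 := by
  intro p hp
  simp only [liftedPoints, Finset.mem_image] at hp
  obtain ⟨m, hm, rfl⟩ := hp
  rw [Ne, eval_rep_mk_eq_zero_iff hF]
  exact h m (mem_standardSet.1 hm)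

lemma isHomogeneous_prod_sub (e : ℕ → K) (j : Fin 4) (n : ℕ) :
    (∏ i ∈ Finset.range n, (X j - C (e i) * X 3) : MvPolynomial (Fin 4) K).IsHomogeneous n := by
  have := IsHomogeneous.prod (Finset.range n)
    (fun i => (X j - C (e i) * X 3 : MvPolynomial (Fin 4) K)) (fun _ => 1)
    fun i _ => (isHomogeneous_X K j).sub (isHomogeneous_C_mul_X _ _)
  simpa using this

lemma isHomogeneous_lifting (e : ℕ → K) (m : ℕ × ℕ × ℕ) :
    (lifting e m).IsHomogeneous (expDegree m) :=
  ((isHomogeneous_prod_sub e 0 _).mul (isHomogeneous_prod_sub e 1 _)).mul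
    (isHomogeneous_prod_sub e 2 _)

lemma isHomogeneous_pow_mul_lifting (e : ℕ → K) (k : ℕ) (m : ℕ × ℕ × ℕ) :
    (X 3 ^ k * lifting e m).IsHomogeneous (k + expDegree m) :=
  (isHomogeneous_X_pow 3 k).mul (isHomogeneous_lifting e m)

lemma prod_sub_ne_zero_iff {e : ℕ → K} (he : Function.Injective e) (a n : ℕ) :
    ∏ i ∈ Finset.range n, (e a - e i) ≠ 0 ↔ n ≤ a := by
  rw [Finset.prod_ne_zero_iff]
  simp only [Finset.mem_range, sub_ne_zero, he.ne_iff]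
  exact ⟨fun h => not_lt.1 fun hlt => h a hlt rfl, fun h i hi => by omega⟩

/-- Each coordinate contributes `∏_{i < m_j} (e_{n_j} - e_i)`, which contains a zero factor exactly
when `n_j < m_j`. -/
lemma eval_lifting_ne_zero_iff {e : ℕ → K} (he : Function.Injective e) (m n : ℕ × ℕ × ℕ) :
    eval (liftingPoint e n) (lifting e m) ≠ 0 ↔ m ≤ n := by
  have : eval (liftingPoint e n) (lifting e m) =
      (∏ i ∈ Finset.range m.1, (e n.1 - e i)) * (∏ i ∈ Finset.range m.2.1, (e n.2.1 - e i)) *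
        ∏ i ∈ Finset.range m.2.2, (e n.2.2 - e i) := by
    simp [lifting, liftingPoint, map_prod]
  rw [this, mul_ne_zero_iff, mul_ne_zero_iff, prod_sub_ne_zero_iff he, prod_sub_ne_zero_iff he,
    prod_sub_ne_zero_iff he, and_assoc]
  rfl

lemma eval_pow_mul_lifting (e : ℕ → K) (k : ℕ) (m n : ℕ × ℕ × ℕ) :
    eval (liftingPoint e n) (X 3 ^ k * lifting e m) = eval (liftingPoint e n) (lifting e m) := by
  simp [liftingPoint]

lemma lifting_mem_pointsIdeal {e : ℕ → K} (he : Function.Injective e) {m : ℕ × ℕ × ℕ}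
    (hm : ¬ IsStandard m) : lifting e m ∈ pointsIdeal (liftedPoints e) := by
  rw [mem_pointsIdeal_liftedPoints e (isHomogeneous_lifting e m)]
  intro n hn
  by_contra h
  exact hm (hn.of_le ((eval_lifting_ne_zero_iff he m n).1 h))

/-- The span is stable under the variables: multiplying a lifting by `x_j` gives the next lifting in
direction `j` plus `e_a w` times the old one, where `a` is the exponent of `x_j`. -/
lemma mem_span_lifting (e : ℕ → K) {t : ℕ} {F : MvPolynomial (Fin 4) K} (hF : F.IsHomogeneous t) :
    F ∈ Submodule.span K {G | ∃ k m, k + expDegree m = t ∧ G = X 3 ^ k * lifting e m} := by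
  refine map_mem_of_isHomogeneous (AlgHom.id K _) (fun t => Submodule.span K
    {G | ∃ k m, k + expDegree m = t ∧ G = X 3 ^ k * lifting e m}) ?_ ?_ hF
  · exact Submodule.subset_span ⟨0, (0, 0, 0), rfl, by simp [lifting]⟩
  · intro i t a ha
    induction ha using Submodule.span_induction with
    | zero => simp
    | add a b _ _ ha hb => rw [mul_add]; exact Submodule.add_mem _ ha hb
    | smul c a _ ha => rw [mul_smul_comm]; exact Submodule.smul_mem _ _ ha
    | mem G hG =>
      obtain ⟨k, ⟨a, b, c⟩, hk, rfl⟩ := hG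
      simp only [expDegree] at hk
      have hw : ∀ r : K, r • (X 3 ^ (k + 1) * lifting e (a, b, c)) ∈ Submodule.span K
          {G | ∃ k m, k + expDegree m = t + 1 ∧ G = X 3 ^ k * lifting e m} := fun r =>
        Submodule.smul_mem _ _ (Submodule.subset_span
          ⟨k + 1, (a, b, c), by simp only [expDegree]; omega, rfl⟩)
      simp only [AlgHom.id_apply]
      fin_cases i
      · have : (X 0 * (X 3 ^ k * lifting e (a, b, c)) : MvPolynomial (Fin 4) K) =
            X 3 ^ k * lifting e (a + 1, b, c) + e a • (X 3 ^ (k + 1) * lifting e (a, b, c)) := by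
          simp only [lifting, Finset.prod_range_succ, smul_eq_C_mul]
          ring
        simp only [Fin.zero_eta]
        rw [this]
        exact Submodule.add_mem _ (Submodule.subset_span
          ⟨k, (a + 1, b, c), by simp only [expDegree]; omega, rfl⟩) (hw _)
      · have : (X 1 * (X 3 ^ k * lifting e (a, b, c)) : MvPolynomial (Fin 4) K) =
            X 3 ^ k * lifting e (a, b + 1, c) + e b • (X 3 ^ (k + 1) * lifting e (a, b, c)) := by
          simp only [lifting, Finset.prod_range_succ, smul_eq_C_mul]
          ring
        simp only [Fin.mk_one]
        rw [this]
        exact Submodule.add_mem _ (Submodule.subset_span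
          ⟨k, (a, b + 1, c), by simp only [expDegree]; omega, rfl⟩) (hw _)
      · have : (X 2 * (X 3 ^ k * lifting e (a, b, c)) : MvPolynomial (Fin 4) K) =
            X 3 ^ k * lifting e (a, b, c + 1) + e c • (X 3 ^ (k + 1) * lifting e (a, b, c)) := by
          simp only [lifting, Finset.prod_range_succ, smul_eq_C_mul]
          ring
        simp only [Fin.reduceFinMk]
        rw [this]
        exact Submodule.add_mem _ (Submodule.subset_span
          ⟨k, (a, b, c + 1), by simp only [expDegree]; omega, rfl⟩) (hw _)
      · have : (X 3 * (X 3 ^ k * lifting e (a, b, c)) : MvPolynomial (Fin 4) K) =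
            (1 : K) • (X 3 ^ (k + 1) * lifting e (a, b, c)) := by
          rw [one_smul]
          ring
        simp only [Fin.reduceFinMk]
        rw [this]
        exact hw 1

/-- The standard exponents of degree at most `t`. -/
def standardLE (t : ℕ) : Finset (ℕ × ℕ × ℕ) := standardSet.filter fun m => expDegree m ≤ t

lemma mem_standardLE {t : ℕ} {m : ℕ × ℕ × ℕ} :
    m ∈ standardLE t ↔ IsStandard m ∧ expDegree m ≤ t := by
  rw [standardLE, Finset.mem_filter, mem_standardSet]

/-- The liftings of standard monomials, made homogeneous of degree `t`. -/
def standardForm (e : ℕ → K) (t : ℕ) (m : standardLE t) : MvPolynomial (Fin 4) K :=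
  X 3 ^ (t - expDegree m.1) * lifting e m.1

lemma isHomogeneous_standardForm (e : ℕ → K) (t : ℕ) (m : standardLE t) :
    (standardForm e t m).IsHomogeneous t := by
  have := isHomogeneous_pow_mul_lifting e (t - expDegree m.1) m.1
  rwa [Nat.sub_add_cancel (mem_standardLE.1 m.2).2] at this

/-- The evaluation matrix of standard forms at the points is triangular for the divisibility order,
with nonzero diagonal. -/
lemma coeff_eq_zero_of_sum_mem {e : ℕ → K} (he : Function.Injective e) {t : ℕ}
    (c : standardLE t → K)
    (h : ∑ m, c m • standardForm e t m ∈ pointsIdeal (liftedPoints e)) (m : standardLE t) :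
    c m = 0 := by
  have hhom : (∑ m, c m • standardForm e t m).IsHomogeneous t :=
    IsHomogeneous.sum _ _ _ fun m _ => by
      rw [smul_eq_C_mul]; exact (isHomogeneous_standardForm e t m).C_mul _
  rw [mem_pointsIdeal_liftedPoints e hhom] at h
  induction hn : expDegree m.1 using Nat.strong_induction_on generalizing m with
  | _ n ih =>
    have h1 := h m.1 (mem_standardLE.1 m.2).1
    rw [map_sum, Finset.sum_eq_single m] at h1
    · rw [smul_eval, standardForm, eval_pow_mul_lifting] at h1
      exact (mul_eq_zero.1 h1).resolve_right ((eval_lifting_ne_zero_iff he _ _).2 le_rfl)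
    · intro k _ hk
      rw [smul_eval, standardForm, eval_pow_mul_lifting]
      by_contra h2
      obtain ⟨hc, hv⟩ := mul_ne_zero_iff.1 h2
      have hle := (eval_lifting_ne_zero_iff he _ _).1 hv
      -- A term that survives at the point of `m` has exponent `k ≤ m` with `k ≠ m`, hence smaller
      -- degree, and its coefficient is already known to vanish.
      refine hc (ih (expDegree k.1) ?_ k rfl)
      have hne : k.1 ≠ m.1 := fun h => hk (Subtype.ext h)
      obtain ⟨⟨k1, k2, k3⟩, hk'⟩ := k
      obtain ⟨⟨m1, m2, m3⟩, hm'⟩ := m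
      obtain ⟨l1, l2, l3⟩ := hle
      simp only [ne_eq, Prod.mk.injEq, expDegree] at *
      omega
    · simp

/-- A form of degree `t` is the sum of a combination of standard forms and of a combination of
liftings of nonstandard monomials. -/
lemma mem_span_standard_sup (e : ℕ → K) {t : ℕ} {F : MvPolynomial (Fin 4) K}
    (hF : F.IsHomogeneous t) :
    F ∈ Submodule.span K (Set.range (standardForm e t)) ⊔ Submodule.span K
      {G | ∃ k m, k + expDegree m = t ∧ ¬ IsStandard m ∧ G = X 3 ^ k * lifting e m} := by
  rw [← Submodule.span_union]
  refine Submodule.span_mono ?_ (mem_span_lifting e hF)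
  rintro _ ⟨k, m, hk, rfl⟩
  by_cases hm : IsStandard m
  · refine Or.inl ⟨⟨m, mem_standardLE.2 ⟨hm, by omega⟩⟩, ?_⟩
    have : t - expDegree m = k := by omega
    simp only [standardForm, this]
  · exact Or.inr ⟨k, m, hk, hm, rfl⟩

lemma span_nonstandard_le {e : ℕ → K} (he : Function.Injective e) (t : ℕ) :
    Submodule.span K
      {G | ∃ k m, k + expDegree m = t ∧ ¬ IsStandard m ∧ G = X 3 ^ k * lifting e m} ≤
      (pointsIdeal (liftedPoints e)).restrictScalars K := by
  refine Submodule.span_le.2 ?_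
  rintro _ ⟨k, m, _, hm, rfl⟩
  exact Ideal.mul_mem_left _ _ (lifting_mem_pointsIdeal he hm)

/-- The forms vanishing on the lifted points are the combinations of the liftings of the
nonstandard monomials. -/
lemma mem_span_nonstandard {e : ℕ → K} (he : Function.Injective e) {t : ℕ}
    {F : MvPolynomial (Fin 4) K} (hF : F.IsHomogeneous t)
    (h : F ∈ pointsIdeal (liftedPoints e)) : F ∈ Submodule.span K
      {G | ∃ k m, k + expDegree m = t ∧ ¬ IsStandard m ∧ G = X 3 ^ k * lifting e m} := by
  obtain ⟨u, hu, v, hv, rfl⟩ := Submodule.mem_sup.1 (mem_span_standard_sup e hF)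
  have hv' : v ∈ pointsIdeal (liftedPoints e) := span_nonstandard_le he t hv
  have hu' := (Ideal.add_mem_iff_left _ hv').1 h
  obtain ⟨c, rfl⟩ := (Submodule.mem_span_range_iff_exists_fun K).1 hu
  have hc := coeff_eq_zero_of_sum_mem he c hu'
  simpa [hc] using hv

lemma hilbertFunction_liftedPoints {e : ℕ → K} (he : Function.Injective e) (t : ℕ) :
    hilbertFunction (pointsIdeal (liftedPoints e)) t = (standardLE t).card := by
  set I := pointsIdeal (liftedPoints e) with hI
  have hli : LinearIndependent K fun m => Ideal.Quotient.mk I (standardForm e t m) := by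
    rw [Fintype.linearIndependent_iff]
    intro c hc
    refine coeff_eq_zero_of_sum_mem he c ?_
    rw [← hI, ← Ideal.Quotient.eq_zero_iff_mem, ← hc, map_sum]
    rfl
  have hspan : gradedPiece I t =
      Submodule.span K (Set.range fun m => Ideal.Quotient.mk I (standardForm e t m)) := by
    apply le_antisymm
    · intro a ha
      obtain ⟨F, hF, rfl⟩ := mem_gradedPiece.1 ha
      obtain ⟨u, hu, v, hv, rfl⟩ := Submodule.mem_sup.1 (mem_span_standard_sup e hF)
      have hv' : v ∈ I := span_nonstandard_le he t hv
      obtain ⟨c, rfl⟩ := (Submodule.mem_span_range_iff_exists_fun K).1 hu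
      rw [map_add, Ideal.Quotient.eq_zero_iff_mem.2 hv', add_zero, map_sum]
      exact Submodule.sum_mem _ fun m _ =>
        Submodule.smul_mem _ (c m) (Submodule.subset_span (Set.mem_range_self m))
    · refine Submodule.span_le.2 ?_
      rintro _ ⟨m, rfl⟩
      exact mk_mem_gradedPiece I (isHomogeneous_standardForm e t m)
  rw [hilbertFunction, hspan, finrank_span_eq_card hli, Fintype.card_coe]

/-- The entries are the partial sums of the `h`-vector; the default 37 is the total number of
points, reached in degree 6. -/
lemma card_standardLE (t : ℕ) :
    (standardLE t).card = ([1, 4, 9, 16, 24, 31] : List ℕ).getD t 37 := by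
  by_cases ht : t < 6
  · interval_cases t <;> decide +kernel
  · have : standardLE t = standardSet := Finset.filter_true_of_mem fun m hm =>
      (mem_standardSet.1 hm).expDegree_le.trans (not_lt.1 ht)
    rw [this, List.getD_eq_default _ _ (by simpa using ht)]
    decide +kernel

lemma hVector_liftedPoints {e : ℕ → K} (he : Function.Injective e) (t : ℕ) :
    hVector (pointsIdeal (liftedPoints e)) t = ([1, 3, 5, 7, 8, 7, 6] : List ℤ).getD t 0 := by
  match t with
  | 0 | 1 | 2 | 3 | 4 | 5 | 6 =>
    simp [hVector, hilbertFunction_liftedPoints he, card_standardLE]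
  | t + 7 => simp [hVector, hilbertFunction_liftedPoints he, card_standardLE]

end Lifting

/-! ### The Artinian reduction and levelness -/

section Level

variable {K : Type*} [Field K]

lemma isArtinianReduction_liftedPoints {e : ℕ → K} (he : Function.Injective e)
    {ℓ : MvPolynomial (Fin 4) K} (hℓ : ℓ.IsHomogeneous 1)
    (h : ∀ m, IsStandard m → eval (liftingPoint e m) ℓ ≠ 0) :
    IsArtinianReduction (pointsIdeal (liftedPoints e)) ℓ := by
  have h' := eval_rep_ne_zero e hℓ h
  refine ⟨hℓ, mk_mem_nonZeroDivisors hℓ h',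
    isArtinianRing_of_gradedPiece_eq_bot (N := 7) fun t ht F hF => ?_⟩
  refine mem_of_hilbertFunction_eq_zero ?_ hF
  obtain ⟨s, rfl⟩ := Nat.exists_eq_add_of_le' ht
  have h1 := hilbertFunction_reductionIdeal hℓ h' (s + 6)
  rw [hVector_liftedPoints he] at h1
  simpa using h1

/-- The monomial ideal generated by `w` and the nonstandard monomials. -/
def nonstandardIdeal (K : Type*) [Field K] : Ideal (MvPolynomial (Fin 4) K) :=
  Ideal.span ((fun s => monomial s (1 : K)) ''
    {s : Fin 4 →₀ ℕ | s 3 ≠ 0 ∨ ¬ IsStandard (s 0, s 1, s 2)})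

lemma mem_nonstandardIdeal {F : MvPolynomial (Fin 4) K} : F ∈ nonstandardIdeal K ↔
    ∀ s ∈ F.support, s 3 ≠ 0 ∨ ¬ IsStandard (s 0, s 1, s 2) := by
  rw [nonstandardIdeal, mem_ideal_span_monomial_image]
  refine forall₂_congr fun s _ => ⟨?_, fun h => ⟨s, h, le_rfl⟩⟩
  rintro ⟨r, hr | hr, hrs⟩
  · have := hrs 3
    exact Or.inl (by omega)
  · exact Or.inr fun hs => hr (hs.of_le ⟨hrs 0, hrs 1, hrs 2⟩)

lemma monomial_eq_prod (s : Fin 4 →₀ ℕ) : monomial s (1 : K) =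
    X 0 ^ s 0 * X 1 ^ s 1 * X 2 ^ s 2 * X 3 ^ s 3 := by
  rw [monomial_eq, Finsupp.prod_fintype _ _ (by simp), Fin.prod_univ_four, map_one, one_mul]

lemma lifting_sub_mem_span (e : ℕ → K) (m : ℕ × ℕ × ℕ) :
    lifting e m - X 0 ^ m.1 * X 1 ^ m.2.1 * X 2 ^ m.2.2 ∈
      Ideal.span {(X 3 : MvPolynomial (Fin 4) K)} := by
  have h : Ideal.Quotient.mk (Ideal.span {(X 3 : MvPolynomial (Fin 4) K)}) (X 3) = 0 :=
    Ideal.Quotient.eq_zero_iff_mem.2 (Ideal.mem_span_singleton_self _)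
  rw [← Ideal.Quotient.eq]
  simp [lifting, map_prod, h]

lemma X_three_mem_nonstandardIdeal : (X 3 : MvPolynomial (Fin 4) K) ∈ nonstandardIdeal K := by
  refine Ideal.subset_span ⟨Finsupp.single 3 1, Or.inl (by simp), rfl⟩

lemma lifting_mem_nonstandardIdeal (e : ℕ → K) {m : ℕ × ℕ × ℕ} (hm : ¬ IsStandard m) :
    lifting e m ∈ nonstandardIdeal K := by
  have h1 : Ideal.span {(X 3 : MvPolynomial (Fin 4) K)} ≤ nonstandardIdeal K :=
    (Ideal.span_singleton_le_iff_mem _).2 X_three_mem_nonstandardIdeal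
  have h2 : X 0 ^ m.1 * X 1 ^ m.2.1 * X 2 ^ m.2.2 ∈ nonstandardIdeal K := by
    refine Ideal.subset_span
      ⟨Finsupp.equivFunOnFinite.symm ![m.1, m.2.1, m.2.2, 0], Or.inr (by simpa using hm), ?_⟩
    simp [monomial_eq_prod]
  simpa using Ideal.add_mem _ (h1 (lifting_sub_mem_span e m)) h2

/-- Modulo `w` every lifting becomes its monomial, and the forms in the ideal of the points are
spanned by multiples of liftings of nonstandard monomials. -/
lemma reductionIdeal_X_three {e : ℕ → K} (he : Function.Injective e) :
    reductionIdeal (pointsIdeal (liftedPoints e)) (X 3) = nonstandardIdeal K := by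
  apply le_antisymm
  · refine sup_le (Ideal.span_le.2 ?_)
      ((Ideal.span_singleton_le_iff_mem _).2 X_three_mem_nonstandardIdeal)
    rintro F ⟨⟨d, hF⟩, h⟩
    have hspan := mem_span_nonstandard he hF ((mem_pointsIdeal hF).2 h)
    have hle : Submodule.span K
        {G | ∃ k m, k + expDegree m = d ∧ ¬ IsStandard m ∧ G = X 3 ^ k * lifting e m} ≤
        (nonstandardIdeal K).restrictScalars K := by
      refine Submodule.span_le.2 ?_
      rintro _ ⟨k, m, _, hm, rfl⟩
      exact Ideal.mul_mem_left _ _ (lifting_mem_nonstandardIdeal e hm)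
    exact hle hspan
  · refine Ideal.span_le.2 ?_
    have hX : X 3 ∈ reductionIdeal (pointsIdeal (liftedPoints e)) (X 3) :=
      Ideal.mem_sup_right (Ideal.mem_span_singleton_self _)
    rintro _ ⟨s, hs, rfl⟩
    simp only [monomial_eq_prod]
    by_cases h3 : s 3 = 0
    · have hs' := hs.resolve_left (fun h => h h3)
      rw [h3, pow_zero, mul_one]
      have h1 : lifting e (s 0, s 1, s 2) ∈
          reductionIdeal (pointsIdeal (liftedPoints e)) (X 3) :=
        Ideal.mem_sup_left (lifting_mem_pointsIdeal he hs')
      have h2 : Ideal.span {(X 3 : MvPolynomial (Fin 4) K)} ≤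
        reductionIdeal (pointsIdeal (liftedPoints e)) (X 3) := le_sup_right
      simpa using Ideal.sub_mem _ h1 (h2 (lifting_sub_mem_span e (s 0, s 1, s 2)))
    · exact Ideal.mul_mem_left _ _ (Ideal.pow_mem_of_mem _ hX _ (Nat.pos_of_ne_zero h3))

/-- A standard monomial of degree different from `6` divides another standard monomial. -/
lemma exists_isStandard_add_single {s : Fin 4 →₀ ℕ} (h3 : s 3 = 0)
    (hs : IsStandard (s 0, s 1, s 2)) (hd : s.degree ≠ 6) :
    ∃ (i : Fin 4) (r : Fin 4 →₀ ℕ), r = Finsupp.single i 1 + s ∧ r 3 = 0 ∧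
      IsStandard (r 0, r 1, r 2) := by
  have hdeg : s.degree = s 0 + s 1 + s 2 + s 3 := by
    rw [Finsupp.degree_eq_sum, Fin.sum_univ_four]
  rw [hdeg] at hd
  simp only [IsStandard] at hs
  -- For `x z^c` and `x² z^c` multiply by `x`. Otherwise the monomial is `y^b z^c` of degree below
  -- 6, or `x³ z^c` with `c < 3`, and `z` works.
  by_cases h : 1 ≤ s 0 ∧ s 0 ≤ 2
  · refine ⟨0, _, rfl, ?_, ?_⟩ <;> simp [IsStandard] <;> omega
  · refine ⟨2, _, rfl, ?_, ?_⟩ <;> simp [IsStandard] <;> omega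

/-- Reduce by `w`, which equals 1 at the chosen coordinates of every point. In the resulting
monomial algebra a socle element has no standard term outside degree 6, since such a term survives
multiplication by some variable. -/
lemma isLevel_liftedPoints {e : ℕ → K} (he : Function.Injective e) :
    IsLevel (liftedPoints e) := by
  have hA := isArtinianReduction_liftedPoints he (isHomogeneous_X K (3 : Fin 4))
    (by simp [liftingPoint])
  refine ⟨X 3, hA, hA.2.2, 6, ?_⟩
  rw [reductionIdeal_X_three he]
  intro a ha
  obtain ⟨F, rfl⟩ := Ideal.Quotient.mk_surjective a
  refine mem_gradedPiece.2
    ⟨homogeneousComponent 6 F, homogeneousComponent_isHomogeneous 6 F, Eq.symm ?_⟩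
  rw [Ideal.Quotient.eq, mem_nonstandardIdeal]
  intro s hs
  rw [mem_support_iff, coeff_sub, coeff_homogeneousComponent] at hs
  by_contra hcon
  obtain ⟨h3, hstd⟩ := not_or.1 hcon
  have hd : s.degree ≠ 6 := fun h => by simp [h] at hs
  rw [if_neg hd, sub_zero] at hs
  obtain ⟨i, r, rfl, hi3, histd⟩ := exists_isStandard_add_single (not_not.1 h3) (not_not.1 hstd) hd
  have hi := ha i
  rw [← map_mul, Ideal.Quotient.eq_zero_iff_mem, mem_nonstandardIdeal] at hi
  refine (hi _ ?_).elim (fun h => h hi3) fun h => h histd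
  -- Multiplication by a variable merely shifts exponents, so the coefficient of `X i * F` at the
  -- standard exponent `r` is that of `F` at `s`.
  rw [mem_support_iff, coeff_X_mul]
  exact hs

end Level

/-! ### Restriction to a line, and quotients by two linear forms -/

section LefschetzProperties

variable {K : Type*} [Field K]

/-- The coefficient of the variable `x_i` in a form. -/
def linCoeff (ℓ : MvPolynomial (Fin 4) K) (i : Fin 4) : K := coeff (Finsupp.single i 1) ℓ

lemma eq_sum_linCoeff {ℓ : MvPolynomial (Fin 4) K} (hℓ : ℓ.IsHomogeneous 1) :
    ℓ = C (linCoeff ℓ 0) * X 0 + C (linCoeff ℓ 1) * X 1 + C (linCoeff ℓ 2) * X 2 +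
      C (linCoeff ℓ 3) * X 3 := by
  have h : ℓ ∈ homogeneousSubmodule (Fin 4) K 1 := hℓ
  rw [homogeneousSubmodule_one_eq_span_X, Submodule.mem_span_range_iff_exists_fun] at h
  obtain ⟨c, rfl⟩ := h
  simp [linCoeff, Fin.sum_univ_four, coeff_X, Finsupp.single_left_inj, smul_eq_C_mul]

/-- Restriction of forms to the line `x = ℓ = 0`, with the parameter `T = y / w`. -/
def lineMap (ℓ : MvPolynomial (Fin 4) K) : MvPolynomial (Fin 4) K →ₐ[K] Polynomial K :=
  aeval ![0, Polynomial.X, Polynomial.C (-linCoeff ℓ 3 / linCoeff ℓ 2) +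
    Polynomial.C (-linCoeff ℓ 1 / linCoeff ℓ 2) * Polynomial.X, 1]

lemma lineMap_self {ℓ : MvPolynomial (Fin 4) K} (hℓ : ℓ.IsHomogeneous 1)
    (h2 : linCoeff ℓ 2 ≠ 0) : lineMap ℓ ℓ = 0 := by
  have h := congrArg (lineMap ℓ) (eq_sum_linCoeff hℓ)
  have hC : ∀ a, Polynomial.C (linCoeff ℓ 2) * Polynomial.C (-a / linCoeff ℓ 2) =
      -Polynomial.C a := fun a => by
    rw [← Polynomial.C_mul, mul_div_cancel₀ _ h2, Polynomial.C_neg]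
  have hX : ∀ a i, lineMap ℓ (C a * X i) = Polynomial.C a * lineMap ℓ (X i) := fun a i => by
    rw [map_mul, algHom_C, Polynomial.algebraMap_eq]
  rw [h, map_add, map_add, map_add, hX, hX, hX, hX]
  simp only [lineMap, aeval_X, Matrix.cons_val]
  linear_combination hC (linCoeff ℓ 3) + Polynomial.X * hC (linCoeff ℓ 1)

lemma lineMap_mem_degreeLT (ℓ : MvPolynomial (Fin 4) K) {t : ℕ} {F : MvPolynomial (Fin 4) K}
    (hF : F.IsHomogeneous t) : lineMap ℓ F ∈ Polynomial.degreeLT K (t + 1) := by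
  refine map_mem_of_isHomogeneous (lineMap ℓ) (fun t => Polynomial.degreeLT K (t + 1)) ?_ ?_ hF
  · simp [Polynomial.mem_degreeLT]
  · intro i t a ha
    have hX : (lineMap ℓ (X i)).natDegree ≤ 1 := by
      fin_cases i <;> simp only [lineMap, aeval_X, Fin.zero_eta, Fin.mk_one, Fin.reduceFinMk,
        Matrix.cons_val] <;> compute_degree <;> norm_num
    rw [Polynomial.mem_degreeLT] at ha ⊢
    by_cases h0 : lineMap ℓ (X i) * a = 0
    · rw [h0, Polynomial.degree_zero]
      exact WithBot.bot_lt_coe _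
    · have h1 := (Polynomial.natDegree_lt_iff_degree_lt (right_ne_zero_of_mul h0)).2 ha
      rw [← Polynomial.natDegree_lt_iff_degree_lt h0]
      have := Polynomial.natDegree_mul_le (p := lineMap ℓ (X i)) (q := a)
      omega

/-- On the line `x = ℓ = 0`, surjectivity would write the 6-dimensional space of polynomials of
degree at most 5 as a sum of the image of a 4-dimensional space and a line. The argument applies to
every quadric, not only to a general one. -/
lemma not_mulSurjective_liftedPoints {e : ℕ → K} (he : Function.Injective e) (he0 : e 0 = 0)
    {ℓ : MvPolynomial (Fin 4) K} (hℓ : ℓ.IsHomogeneous 1) (h2 : linCoeff ℓ 2 ≠ 0)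
    {Q : MvPolynomial (Fin 4) K} (hQ : Q.IsHomogeneous 2) :
    ¬ MulSurjective (reductionIdeal (pointsIdeal (liftedPoints e)) ℓ) 2 Q 3 := by
  intro hsurj
  set f := lineMap ℓ (lifting e (0, 5, 0)) with hf
  have hI : ∀ F : MvPolynomial (Fin 4) K, F.IsHomogeneous 5 → F ∈ pointsIdeal (liftedPoints e) →
      lineMap ℓ F ∈ Submodule.span K {f} := by
    intro F hF h
    have hle : Submodule.span K
        {G | ∃ k m, k + expDegree m = 5 ∧ ¬ IsStandard m ∧ G = X 3 ^ k * lifting e m} ≤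
        (Submodule.span K {f}).comap (lineMap ℓ).toLinearMap := by
      refine Submodule.span_le.2 ?_
      rintro _ ⟨k, ⟨a, b, c⟩, hk, hm, rfl⟩
      change lineMap ℓ (X 3 ^ k * lifting e (a, b, c)) ∈ Submodule.span K {f}
      rcases a with _ | a
      · simp only [expDegree] at hk
        -- The total degree is 5, so without `x` only the bound on the exponent of `y` can fail;
        -- this leaves `y⁵` alone.
        have hb : ¬ b ≤ 4 := fun hb => hm (Or.inl ⟨rfl, hb, by dsimp only; omega⟩)
        obtain ⟨rfl, rfl, rfl⟩ : k = 0 ∧ b = 5 ∧ c = 0 := by omega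
        rw [pow_zero, one_mul]
        exact Submodule.mem_span_singleton_self f
      -- As `e 0 = 0`, the lifting contains the factor `x`, which is zero on the line.
      · have : lineMap ℓ (X 3 ^ k * lifting e (a + 1, b, c)) = 0 := by
          simp [lineMap, lifting, Finset.prod_range_succ', he0]
        rw [this]
        exact Submodule.zero_mem _
    exact hle (mem_span_nonstandard he hF h)
  have hle : Polynomial.degreeLT K 6 ≤ (Polynomial.degreeLT K 4).map
      (LinearMap.mulLeft K (lineMap ℓ Q)) ⊔ Submodule.span K {f} := by
    classical
    rw [Polynomial.degreeLT_eq_span_X_pow, Submodule.span_le]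
    intro p hp
    simp only [Finset.coe_image, Set.mem_image, Finset.coe_range, Set.mem_Iio] at hp
    obtain ⟨i, hi, rfl⟩ := hp
    -- The form `y^i w^(5-i)` restricts to `T^i`, so forms of degree 5 already reach every
    -- polynomial of degree at most 5.
    have hF : (X 1 ^ i * X 3 ^ (5 - i) : MvPolynomial (Fin 4) K).IsHomogeneous 5 := by
      have := (isHomogeneous_X_pow (R := K) (1 : Fin 4) i).mul
        (isHomogeneous_X_pow (3 : Fin 4) (5 - i))
      rwa [Nat.add_sub_cancel' (by omega)] at this
    have hFp : lineMap ℓ (X 1 ^ i * X 3 ^ (5 - i)) = Polynomial.X ^ i := by simp [lineMap]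
    obtain ⟨a, ha, hab⟩ := hsurj _ (mk_mem_gradedPiece _ hF)
    obtain ⟨G, hG, rfl⟩ := mem_gradedPiece.1 ha
    rw [← map_mul] at hab
    have hQG : (Q * G).IsHomogeneous 5 := hQ.mul hG
    obtain ⟨H, hH, hmem⟩ := exists_sub_mul_mem (t := 4) (isHomogeneousIdeal_pointsIdeal _) hℓ
      (hF.sub hQG) (Ideal.Quotient.eq.1 hab.symm)
    have hLH : (ℓ * H).IsHomogeneous 5 := hℓ.mul hH
    have hmem' := hI _ ((hF.sub hQG).sub hLH) hmem
    rw [map_sub, map_sub, hFp, map_mul, map_mul, lineMap_self hℓ h2, zero_mul, sub_zero] at hmem'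
    exact Submodule.mem_sup.2
      ⟨_, ⟨_, lineMap_mem_degreeLT ℓ hG, rfl⟩, _, hmem', add_sub_cancel _ _⟩
  have hfin : ∀ n, Module.finrank K (Polynomial.degreeLT K n) = n := fun n => by
    rw [(Polynomial.degreeLTEquiv K n).finrank_eq, Module.finrank_fin_fun]
  have : ∀ n, Module.Finite K (Polynomial.degreeLT K n) := fun n =>
    Module.Finite.equiv (Polynomial.degreeLTEquiv K n).symm
  have h1 := Submodule.finrank_mono hle
  have h3 := Submodule.finrank_add_le_finrank_add_finrank ((Polynomial.degreeLT K 4).map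
      (LinearMap.mulLeft K (lineMap ℓ Q))) (Submodule.span K {f})
  have h4 := Submodule.finrank_map_le (LinearMap.mulLeft K (lineMap ℓ Q)) (Polynomial.degreeLT K 4)
  have h5 := finrank_span_le_card (R := K) ({f} : Set (Polynomial K))
  rw [Set.toFinset_singleton, Finset.card_singleton] at h5
  rw [hfin] at h1 h4
  omega

/-- The factor for `i = 0` is `x` itself. Once a factor `x` is present, `xy = 0` kills the `y`-part
of `w`, so each further factor acts as `(1 - e_i γ) x`. The product must therefore have at least one
factor. -/
lemma prod_sub_of_mul_eq_zero {A : Type*} [CommRing A] [Algebra K A] {x y w : A} (hxy : x * y = 0)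
    {e : ℕ → K} (he0 : e 0 = 0) {γ δ : K} (hw : w = γ • x + δ • y) (n : ℕ) :
    ∏ i ∈ Finset.range (n + 1), (x - algebraMap K A (e i) * w) =
      (∏ i ∈ Finset.range (n + 1), (1 - e i * γ)) • x ^ (n + 1) := by
  induction n with
  | zero => simp [he0]
  | succ n ih =>
    rw [Finset.prod_range_succ, ih, Finset.prod_range_succ _ (n + 1), hw]
    simp only [Algebra.smul_def, map_mul, map_sub, map_one, pow_succ]
    linear_combination
      (-(algebraMap K A (∏ i ∈ Finset.range (n + 1), (1 - e i * γ))) * x ^ n *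
        algebraMap K A (e (n + 1)) * algebraMap K A δ) * hxy

lemma add_mul_mem_span_pow {A : Type*} [CommRing A] [Algebra K A] {x y a : A} (hxy : x * y = 0)
    (p q : K) {t : ℕ} (ha : a ∈ Submodule.span K {x ^ t, y ^ t}) :
    (p • x + q • y) * a ∈ Submodule.span K {x ^ (t + 1), y ^ (t + 1)} := by
  obtain ⟨r, s, rfl⟩ := Submodule.mem_span_pair.1 ha
  rw [Submodule.mem_span_pair]
  rcases t with _ | t
  · refine ⟨(r + s) * p, (r + s) * q, ?_⟩
    simp only [Algebra.smul_def, map_mul, map_add, zero_add, pow_one, pow_zero]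
    ring
  · refine ⟨r * p, s * q, ?_⟩
    simp only [Algebra.smul_def, map_mul, pow_succ]
    linear_combination (-(algebraMap K A p * algebraMap K A s * y ^ t) -
      algebraMap K A q * algebraMap K A r * x ^ t) * hxy

lemma mk_eq_smul_add_smul {J : Ideal (MvPolynomial (Fin 4) K)} {i : Fin 4} {p q : K}
    (h : X i - (C p * X 0 + C q * X 1) ∈ J) : Ideal.Quotient.mk J (X i) =
      p • Ideal.Quotient.mk J (X 0) + q • Ideal.Quotient.mk J (X 1) := by
  rw [Ideal.Quotient.eq.2 h, C_mul', C_mul']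
  rfl

/-- In a quotient of `K[x, y, z, w]` in which `z` and `w` are combinations of `x` and `y` and
`xy = 0`, the forms of degree `t` are the combinations of `x^t` and `y^t`. -/
lemma gradedPiece_le_span {J : Ideal (MvPolynomial (Fin 4) K)} {α β γ δ : K}
    (hxy : X 0 * X 1 ∈ J) (hz : X 2 - (C α * X 0 + C β * X 1) ∈ J)
    (hw : X 3 - (C γ * X 0 + C δ * X 1) ∈ J) (t : ℕ) :
    gradedPiece J t ≤ Submodule.span K
      {Ideal.Quotient.mk J (X 0) ^ t, Ideal.Quotient.mk J (X 1) ^ t} := by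
  set x := Ideal.Quotient.mk J (X 0) with hx
  set y := Ideal.Quotient.mk J (X 1) with hy
  have hxy' : x * y = 0 := by rw [hx, hy, ← map_mul]; exact Ideal.Quotient.eq_zero_iff_mem.2 hxy
  have hlin : ∀ i : Fin 4, ∃ p q : K, Ideal.Quotient.mkₐ K J (X i) = p • x + q • y := by
    intro i
    fin_cases i
    · exact ⟨1, 0, by simp [hx]⟩
    · exact ⟨0, 1, by simp [hy]⟩
    · exact ⟨α, β, mk_eq_smul_add_smul hz⟩
    · exact ⟨γ, δ, mk_eq_smul_add_smul hw⟩
  intro a ha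
  obtain ⟨F, hF, rfl⟩ := mem_gradedPiece.1 ha
  refine map_mem_of_isHomogeneous (Ideal.Quotient.mkₐ K J)
    (fun t => Submodule.span K {x ^ t, y ^ t}) (Submodule.subset_span (by simp)) ?_ hF
  intro i t a ha
  obtain ⟨p, q, hpq⟩ := hlin i
  rw [hpq]
  exact add_mul_mem_span_pow hxy' p q ha

lemma hilbertFunction_le_of_le_span {J : Ideal (MvPolynomial (Fin 4) K)} {t : ℕ}
    (s : Finset (MvPolynomial (Fin 4) K ⧸ J)) (h : gradedPiece J t ≤ Submodule.span K s) :
    hilbertFunction J t ≤ s.card := by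
  have := Module.Finite.span_finset K s
  exact (Submodule.finrank_mono h).trans (finrank_span_finset_le_card s)

lemma hilbertFunction_zero_le (J : Ideal (MvPolynomial (Fin 4) K)) : hilbertFunction J 0 ≤ 1 := by
  refine hilbertFunction_le_of_le_span {1} ?_
  intro a ha
  obtain ⟨F, hF, rfl⟩ := mem_gradedPiece.1 ha
  rw [← mem_homogeneousSubmodule, homogeneousSubmodule_zero] at hF
  obtain ⟨c, rfl⟩ := Submodule.mem_one.1 hF
  rw [Finset.coe_singleton, Submodule.mem_span_singleton]
  exact ⟨c, (Algebra.algebraMap_eq_smul_one (A := MvPolynomial (Fin 4) K ⧸ J) c).symm⟩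

/-- The Hilbert function of a quotient of `K[x, y, z, w]` by two linear forms in general position
and by `xy` and the liftings of `x⁴` and `y⁵` is at most `(1, 2, 2, 2, 1)`. -/
lemma hilbertFunction_le {J : Ideal (MvPolynomial (Fin 4) K)} {α β γ δ : K} {e : ℕ → K}
    (he0 : e 0 = 0) (hxy : X 0 * X 1 ∈ J) (hz : X 2 - (C α * X 0 + C β * X 1) ∈ J)
    (hw : X 3 - (C γ * X 0 + C δ * X 1) ∈ J) (hx4 : lifting e (4, 0, 0) ∈ J)
    (hy5 : lifting e (0, 5, 0) ∈ J) (hγ : ∏ i ∈ Finset.range 4, (1 - e i * γ) ≠ 0)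
    (hδ : ∏ i ∈ Finset.range 5, (1 - e i * δ) ≠ 0) :
    (∀ t, hilbertFunction J t ≤ 2) ∧ hilbertFunction J 4 ≤ 1 ∧
      ∀ t, 5 ≤ t → hilbertFunction J t = 0 := by
  classical
  have hspan := gradedPiece_le_span hxy hz hw
  set x := Ideal.Quotient.mk J (X 0) with hx
  set y := Ideal.Quotient.mk J (X 1) with hy
  have hxy' : x * y = 0 := by rw [hx, hy, ← map_mul]; exact Ideal.Quotient.eq_zero_iff_mem.2 hxy
  have hw' : Ideal.Quotient.mk J (X 3) = γ • x + δ • y :=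
    mk_eq_smul_add_smul hw
  have hx4' : x ^ 4 = 0 := by
    have h1 := prod_sub_of_mul_eq_zero hxy' he0 hw' 3
    have h2 : ∏ i ∈ Finset.range (3 + 1), (x - algebraMap K _ (e i) *
        Ideal.Quotient.mk J (X 3)) = Ideal.Quotient.mk J (lifting e (4, 0, 0)) := by
      simp only [lifting, map_prod, map_mul, map_sub, Finset.prod_range_zero, mul_one]
      rfl
    rw [h2, Ideal.Quotient.eq_zero_iff_mem.2 hx4] at h1
    exact (smul_eq_zero.1 h1.symm).resolve_left hγ
  have hy5' : y ^ 5 = 0 := by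
    -- Same computation with `x` and `y`, and hence `γ` and `δ`, exchanged.
    have h1 := prod_sub_of_mul_eq_zero ((mul_comm y x).trans hxy') he0
      (hw'.trans (add_comm _ _)) 4
    have h2 : ∏ i ∈ Finset.range (4 + 1), (y - algebraMap K _ (e i) *
        Ideal.Quotient.mk J (X 3)) = Ideal.Quotient.mk J (lifting e (0, 5, 0)) := by
      simp only [lifting, map_prod, map_mul, map_sub, Finset.prod_range_zero, mul_one, one_mul]
      rfl
    rw [h2, Ideal.Quotient.eq_zero_iff_mem.2 hy5] at h1
    exact (smul_eq_zero.1 h1.symm).resolve_left hδ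
  refine ⟨fun t => ?_, ?_, fun t ht => ?_⟩
  · refine (hilbertFunction_le_of_le_span {x ^ t, y ^ t} ?_).trans Finset.card_le_two
    simpa using hspan t
  · refine (hilbertFunction_le_of_le_span {y ^ 4} ?_).trans (Finset.card_singleton _).le
    have := hspan 4
    rw [hx4', Submodule.span_insert_zero] at this
    simpa using this
  · have := hspan t
    rw [pow_eq_zero_of_le (by omega) hx4', pow_eq_zero_of_le ht hy5'] at this
    exact Nat.le_zero.1 (hilbertFunction_le_of_le_span ∅ (by simpa using this))

end LefschetzProperties

/-! ### The Lefschetz properties and general linear forms -/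

section Main

variable {K : Type*} [Field K]

/-- Cramer's rule modulo two linear forms. -/
lemma exists_combination_mem {J : Ideal (MvPolynomial (Fin 4) K)} {ℓ L : MvPolynomial (Fin 4) K}
    (hℓ : ℓ.IsHomogeneous 1) (hL : L.IsHomogeneous 1) (hℓJ : ℓ ∈ J) (hLJ : L ∈ J) {D γ δ : K}
    (hD : D = linCoeff ℓ 2 * linCoeff L 3 - linCoeff ℓ 3 * linCoeff L 2) (hD0 : D ≠ 0)
    (h2 : linCoeff ℓ 2 ≠ 0)
    (hγ : D * γ = -(linCoeff ℓ 2 * linCoeff L 0 - linCoeff ℓ 0 * linCoeff L 2))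
    (hδ : D * δ = -(linCoeff ℓ 2 * linCoeff L 1 - linCoeff ℓ 1 * linCoeff L 2)) :
    X 3 - (C γ * X 0 + C δ * X 1) ∈ J ∧ ∃ α β : K, X 2 - (C α * X 0 + C β * X 1) ∈ J := by
  have hunit : ∀ (c : K) (F : MvPolynomial (Fin 4) K), c ≠ 0 → C c * F ∈ J → F ∈ J := by
    intro c F hc h
    have := J.mul_mem_left (C c⁻¹) h
    rwa [← mul_assoc, ← C_mul, inv_mul_cancel₀ hc, C_1, one_mul] at this
  have hℓ' := eq_sum_linCoeff hℓ
  have hL' := eq_sum_linCoeff hL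
  have hw : X 3 - (C γ * X 0 + C δ * X 1) ∈ J := by
    refine hunit D _ hD0 ?_
    have h1 := J.sub_mem (J.mul_mem_left (C (linCoeff ℓ 2)) hLJ)
      (J.mul_mem_left (C (linCoeff L 2)) hℓJ)
    have hCD := congrArg (C (σ := Fin 4)) hD
    have hCγ := congrArg (C (σ := Fin 4)) hγ
    have hCδ := congrArg (C (σ := Fin 4)) hδ
    simp only [C_mul, C_sub, C_neg] at hCD hCγ hCδ
    convert h1 using 1
    linear_combination X 3 * hCD - X 0 * hCγ - X 1 * hCδ - C (linCoeff ℓ 2) * hL' +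
      C (linCoeff L 2) * hℓ'
  refine ⟨hw, -(linCoeff ℓ 0 + linCoeff ℓ 3 * γ) / linCoeff ℓ 2,
    -(linCoeff ℓ 1 + linCoeff ℓ 3 * δ) / linCoeff ℓ 2, hunit (linCoeff ℓ 2) _ h2 ?_⟩
  have h1 := J.sub_mem hℓJ (J.mul_mem_left (C (linCoeff ℓ 3)) hw)
  have hdiv : ∀ a, (C (linCoeff ℓ 2) * C (-a / linCoeff ℓ 2) : MvPolynomial (Fin 4) K) = -C a :=
    fun a => by rw [← C_mul, mul_div_cancel₀ _ h2, C_neg]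
  have hα := hdiv (linCoeff ℓ 0 + linCoeff ℓ 3 * γ)
  have hβ := hdiv (linCoeff ℓ 1 + linCoeff ℓ 3 * δ)
  rw [C_add, C_mul (a := linCoeff ℓ 3)] at hα hβ
  convert h1 using 1
  linear_combination -X 0 * hα - X 1 * hβ - hℓ'

lemma hilbertFunction_reduction_liftedPoints {e : ℕ → K} (he : Function.Injective e)
    {ℓ : MvPolynomial (Fin 4) K} (hℓ : ℓ.IsHomogeneous 1)
    (h : ∀ m, IsStandard m → eval (liftingPoint e m) ℓ ≠ 0) (t : ℕ) :
    (hilbertFunction (reductionIdeal (pointsIdeal (liftedPoints e)) ℓ) (t + 1) : ℤ) =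
      ([3, 5, 7, 8, 7, 6] : List ℤ).getD t 0 := by
  rw [hilbertFunction_reductionIdeal hℓ (eval_rep_ne_zero e hℓ h), hVector_liftedPoints he]
  rfl

/-- The maximal rank property for a linear form in general position. -/
lemma mulMaximalRank_liftedPoints {e : ℕ → K} (he : Function.Injective e) (he0 : e 0 = 0)
    {ℓ L : MvPolynomial (Fin 4) K} (hℓ : ℓ.IsHomogeneous 1) (hL : L.IsHomogeneous 1)
    (h2 : linCoeff ℓ 2 ≠ 0) (h : ∀ m, IsStandard m → eval (liftingPoint e m) ℓ ≠ 0) {D : K}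
    (hD : D = linCoeff ℓ 2 * linCoeff L 3 - linCoeff ℓ 3 * linCoeff L 2) (hD0 : D ≠ 0)
    (hx : ∀ i < 5, D + e i * (linCoeff ℓ 2 * linCoeff L 0 - linCoeff ℓ 0 * linCoeff L 2) ≠ 0)
    (hy : ∀ i < 5, D + e i * (linCoeff ℓ 2 * linCoeff L 1 - linCoeff ℓ 1 * linCoeff L 2) ≠ 0)
    (t : ℕ) : MulMaximalRank (reductionIdeal (pointsIdeal (liftedPoints e)) ℓ) 1 L t := by
  set J := reductionIdeal (pointsIdeal (liftedPoints e)) ℓ with hJ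
  set M := reductionIdeal J L with hM
  have hJhom : IsHomogeneousIdeal J := (isHomogeneousIdeal_pointsIdeal _).reductionIdeal hℓ
  have hJM : J ≤ M := le_sup_left
  have hIM : ∀ m, ¬ IsStandard m → lifting e m ∈ M := fun m hm =>
    hJM (Ideal.mem_sup_left (lifting_mem_pointsIdeal he hm))
  obtain ⟨hw, α, β, hz⟩ := exists_combination_mem (J := M) hℓ hL
    (hJM (Ideal.mem_sup_right (Ideal.mem_span_singleton_self ℓ)))
    (Ideal.mem_sup_right (Ideal.mem_span_singleton_self L)) hD hD0 h2
    (mul_div_cancel₀ _ hD0) (mul_div_cancel₀ _ hD0)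
  have hxy : X 0 * X 1 ∈ M := by
    have := hIM (1, 1, 0) (by decide)
    simpa [lifting, he0] using this
  -- Cramer's rule gives `γ` and `δ` the form `-a / D`; clearing denominators turns the hypotheses
  -- `hx`, `hy` into nonvanishing of the factors `1 - e_i γ`, `1 - e_i δ`.
  have hne : ∀ i a, D + e i * a ≠ 0 → 1 - e i * (-a / D) ≠ 0 := by
    intro i a ha h0
    apply ha
    field_simp at h0
    linear_combination h0
  obtain ⟨hM2, hM4, hM5⟩ := hilbertFunction_le he0 hxy hz hw
    (hIM (4, 0, 0) (by decide)) (hIM (0, 5, 0) (by decide))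
    (Finset.prod_ne_zero_iff.2 fun i hi => hne i _
      (hx i ((Finset.mem_range.1 hi).trans (by norm_num))))
    (Finset.prod_ne_zero_iff.2 fun i hi => hne i _ (hy i (Finset.mem_range.1 hi)))
  have hrank := finrank_map_add_hilbertFunction hJhom hL
  rw [← hM] at hrank
  have hA : ∀ t, (hilbertFunction J (t + 1) : ℤ) = ([3, 5, 7, 8, 7, 6] : List ℤ).getD t 0 :=
    hilbertFunction_reduction_liftedPoints he hℓ h
  -- The `h`-vector grows by `2, 2, 2, 1` up to degree 4, which matches the bounds for `A / LA`, so
  -- the rank is at least `dim A_t`. From degree 5 on `A / LA` vanishes.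
  by_cases ht : t < 4
  · refine Or.inl (mulInjective_of_le_finrank_map ?_)
    have hr := hrank t
    have h0 := hilbertFunction_zero_le J
    have hA0 := hA 0
    have hA1 := hA 1
    have hA2 := hA 2
    have hA3 := hA 3
    have hMt := hM2 (t + 1)
    simp only [List.getD_cons_zero, List.getD_cons_succ, zero_add, Nat.reduceAdd]
      at hA0 hA1 hA2 hA3
    interval_cases t <;> simp only [zero_add, Nat.reduceAdd] at hr hMt <;> omega
  · refine Or.inr ((mulSurjective_iff J).2 (Submodule.eq_of_le_of_finrank_eq
      (map_mulLeft_le J hL t) ?_).ge)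
    have hr := hrank t
    rwa [hM5 (t + 1) (by omega), add_zero] at hr

lemma hasWLP_liftedPoints {e : ℕ → K} (he : Function.Injective e) (he0 : e 0 = 0)
    {ℓ : MvPolynomial (Fin 4) K} (hℓ : ℓ.IsHomogeneous 1) (h2 : linCoeff ℓ 2 ≠ 0)
    (h : ∀ m, IsStandard m → eval (liftingPoint e m) ℓ ≠ 0) :
    HasWLP (reductionIdeal (pointsIdeal (liftedPoints e)) ℓ) := by
  set Y : Fin 4 → MvPolynomial (Fin 4 →₀ ℕ) K := fun i => X (Finsupp.single i 1) with hY
  set D : MvPolynomial (Fin 4 →₀ ℕ) K := C (linCoeff ℓ 2) * Y 3 - C (linCoeff ℓ 3) * Y 2 with hD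
  have heval : ∀ L : MvPolynomial (Fin 4) K, ∀ i, eval (fun s => coeff s L) (Y i) = linCoeff L i :=
    fun L i => eval_X _
  have hX : ∀ i : Fin 4, linCoeff (X 3 : MvPolynomial (Fin 4) K) i = if i = 3 then 1 else 0 := by
    intro i
    simp [linCoeff, coeff_X, Finsupp.single_left_inj, eq_comm]
  -- This polynomial in the coefficients of `L` is the product of all the general position
  -- conditions. At `L = w` the two minors multiplied by `e i` vanish and every factor reduces to
  -- the coefficient of `z` in `ℓ`, so the open set is nonempty.
  refine ⟨D * ∏ i ∈ Finset.range 5,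
    ((D + C (e i) * (C (linCoeff ℓ 2) * Y 0 - C (linCoeff ℓ 0) * Y 2)) *
      (D + C (e i) * (C (linCoeff ℓ 2) * Y 1 - C (linCoeff ℓ 1) * Y 2))),
    ⟨X 3, isHomogeneous_X K 3, ?_⟩, fun L hL hne t => ?_⟩
  · simp [hD, heval, hX, map_prod, h2]
  · simp only [hD, map_mul, map_prod, map_add, map_sub, eval_C, heval] at hne
    obtain ⟨hD0, hprod⟩ := mul_ne_zero_iff.1 hne
    have hprod' := fun i hi => mul_ne_zero_iff.1
      (Finset.prod_ne_zero_iff.1 hprod i (Finset.mem_range.2 hi))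
    exact mulMaximalRank_liftedPoints he he0 hℓ hL h2 h rfl hD0
      (fun i hi => (hprod' i hi).1) (fun i hi => (hprod' i hi).2) t

/-- Source and target of `×Q : A_3 → A_5` both have dimension 7, so maximal rank in either sense
would force surjectivity. -/
lemma not_hasSLP_liftedPoints {e : ℕ → K} (he : Function.Injective e) (he0 : e 0 = 0)
    {ℓ : MvPolynomial (Fin 4) K} (hℓ : ℓ.IsHomogeneous 1) (h2 : linCoeff ℓ 2 ≠ 0)
    (h : ∀ m, IsStandard m → eval (liftingPoint e m) ℓ ≠ 0) :
    ¬ HasSLP (reductionIdeal (pointsIdeal (liftedPoints e)) ℓ) := by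
  intro hSLP
  obtain ⟨Φ, ⟨Q, hQ, hΦ⟩, hrank⟩ := hSLP 2
  have hns := not_mulSurjective_liftedPoints he he0 hℓ h2 hQ
  refine (hrank Q hQ hΦ 3).elim (fun hinj => hns ?_) hns
  refine (mulSurjective_iff _).2 (Submodule.eq_of_le_of_finrank_eq
    (map_mulLeft_le _ hQ 3) ?_).ge
  rw [hinj.finrank_map]
  have h3 := hilbertFunction_reduction_liftedPoints he hℓ h 2
  have h5 := hilbertFunction_reduction_liftedPoints he hℓ h 4
  exact Nat.cast_injective (R := ℤ) (h3.trans h5.symm)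

lemma eval_liftingPoint_of_isHomogeneous_one (e : ℕ → K) (m : ℕ × ℕ × ℕ)
    {ℓ : MvPolynomial (Fin 4) K} (hℓ : ℓ.IsHomogeneous 1) : eval (liftingPoint e m) ℓ =
      linCoeff ℓ 0 * e m.1 + linCoeff ℓ 1 * e m.2.1 + linCoeff ℓ 2 * e m.2.2 + linCoeff ℓ 3 := by
  have := congrArg (eval (liftingPoint e m)) (eq_sum_linCoeff hℓ)
  rw [this]
  simp [liftingPoint]

/-- A general linear form contains the variable `z` and does not vanish at the lifted points. -/
lemma forGeneralForm_linear [Infinite K] (e : ℕ → K) {P : MvPolynomial (Fin 4) K → Prop}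
    (hP : ∀ ℓ : MvPolynomial (Fin 4) K, ℓ.IsHomogeneous 1 → linCoeff ℓ 2 ≠ 0 →
      (∀ m, IsStandard m → eval (liftingPoint e m) ℓ ≠ 0) → P ℓ) : ForGeneralForm 1 P := by
  classical
  set Y : Fin 4 → MvPolynomial (Fin 4 →₀ ℕ) K := fun i => X (Finsupp.single i 1) with hY
  set Φ : MvPolynomial (Fin 4 →₀ ℕ) K := Y 2 * ∏ m ∈ standardSet,
    (Y 0 * C (e m.1) + Y 1 * C (e m.2.1) + Y 2 * C (e m.2.2) + Y 3) with hΦ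
  have heval : ∀ ℓ : MvPolynomial (Fin 4) K, ℓ.IsHomogeneous 1 →
      (eval (fun s => coeff s ℓ) Φ ≠ 0 ↔ linCoeff ℓ 2 ≠ 0 ∧
        ∀ m, IsStandard m → eval (liftingPoint e m) ℓ ≠ 0) := by
    intro ℓ hℓ
    have hYi : ∀ i, eval (fun s => coeff s ℓ) (Y i) = linCoeff ℓ i := fun i => eval_X _
    simp only [hΦ, map_mul, map_prod, map_add, eval_C, hYi, mul_ne_zero_iff,
      Finset.prod_ne_zero_iff, mem_standardSet, eval_liftingPoint_of_isHomogeneous_one e _ hℓ]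
  refine ⟨Φ, ?_, fun ℓ hℓ h => hP ℓ hℓ ((heval ℓ hℓ).1 h).1 ((heval ℓ hℓ).1 h).2⟩
  -- The witness is `s z + w`, with value `s e_c + 1` at the point of `(a, b, c)`. Finitely many `s`
  -- are excluded; a spurious value `-1 / 0` does no harm.
  obtain ⟨s, hs⟩ := Infinite.exists_notMem_finset
    (insert 0 (standardSet.image fun m => -1 / e m.2.2))
  rw [Finset.mem_insert, not_or] at hs
  have hhom : (C s * X 2 + X 3 : MvPolynomial (Fin 4) K).IsHomogeneous 1 :=
    (isHomogeneous_C_mul_X s 2).add (isHomogeneous_X K 3)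
  refine ⟨C s * X 2 + X 3, hhom, (heval _ hhom).2 ⟨?_, fun m hm h0 => hs.2 ?_⟩⟩
  · simpa [linCoeff, coeff_X, Finsupp.single_left_inj] using hs.1
  · refine Finset.mem_image.2 ⟨m, mem_standardSet.2 hm, ?_⟩
    simp only [liftingPoint, map_add, map_mul, eval_C, eval_X, Matrix.cons_val] at h0
    have hne : e m.2.2 ≠ 0 := fun h => by simp [h] at h0
    rw [div_eq_iff hne]
    linear_combination -h0

end Main

end Lefschetz

end

theorem proposition5p1 (K : Type*) [Field K] [Infinite K] :
    ∃ Z : Finset (Projectivization K (Fin 4 → K)),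
      Lefschetz.IsLevel Z ∧
      (∀ t : ℕ, Lefschetz.hVector (Lefschetz.pointsIdeal Z) t =
        ([1, 3, 5, 7, 8, 7, 6] : List ℤ).getD t 0) ∧
      Lefschetz.ForGeneralForm 1 (fun ℓ : MvPolynomial (Fin 4) K =>
        Lefschetz.IsArtinianReduction (Lefschetz.pointsIdeal Z) ℓ ∧
        Lefschetz.HasWLP (Lefschetz.reductionIdeal (Lefschetz.pointsIdeal Z) ℓ) ∧
        ¬ Lefschetz.HasSLP (Lefschetz.reductionIdeal (Lefschetz.pointsIdeal Z) ℓ) ∧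
        Lefschetz.ForGeneralForm 2 (fun Q : MvPolynomial (Fin 4) K =>
          ¬ Lefschetz.MulSurjective
            (Lefschetz.reductionIdeal (Lefschetz.pointsIdeal Z) ℓ) 2 Q 3)) := by
  -- Distinct scalars exist because `K` is infinite; the translation arranges `e 0 = 0`.
  set e : ℕ → K := fun n => Infinite.natEmbedding K n - Infinite.natEmbedding K 0 with hedef
  have he : Function.Injective e := fun a b h =>
    (Infinite.natEmbedding K).injective (sub_left_injective h)
  have he0 : e 0 = 0 := sub_self _
  refine ⟨Lefschetz.liftedPoints e, Lefschetz.isLevel_liftedPoints he,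
    Lefschetz.hVector_liftedPoints he, Lefschetz.forGeneralForm_linear e fun ℓ hℓ h2 h =>
      ⟨Lefschetz.isArtinianReduction_liftedPoints he hℓ h,
        Lefschetz.hasWLP_liftedPoints he he0 hℓ h2 h,
        Lefschetz.not_hasSLP_liftedPoints he he0 hℓ h2 h,
        -- The open set of quadrics is the whole space, cut out by the constant polynomial 1.
        1, ⟨0, isHomogeneous_zero _ _ _, by simp⟩, fun Q hQ _ =>
          Lefschetz.not_mulSurjective_liftedPoints he he0 hℓ h2 hQ⟩⟩
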